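/- A curve is the image of a continuous function $\phi:[0,1]\to\mathbb{R}^2$; it is $x$-monotone if every vertical line intersects it in at most one point. The disjointness graph of a family of curves is the graph whose vertices are the curves of the family, two distinct curves being joined by an edge if and only if they are disjoint. **Theorem.** For every positive integer $k$, let $f(k)$ denote the smallest $m$ such that every $K_{k+1}$-free disjointness graph of a (finite or infinite) family of $x$-monotone curves can be properly colored with $m$ colors. Then $f(k)$ exists, its value does not change if only finite families are considered, and $$\frac{k+1}{2}\binom{k+2}{3}\;\le\; f(k)\;\le\; k^{2}\binom{k+1}{2}.$$ -/

import Mathlib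

/-- A curve in the plane: the image of a continuous function on `[0, 1]`. -/
def IsCurve (C : Set (ℝ × ℝ)) : Prop :=
  ∃ φ : unitInterval → ℝ × ℝ, Continuous φ ∧ Set.range φ = C

/-- An `x`-monotone curve: every vertical line meets the curve in at most one point. -/
def IsXMonotoneCurve (C : Set (ℝ × ℝ)) : Prop :=
  IsCurve C ∧ ∀ a : ℝ, (C ∩ {p : ℝ × ℝ | p.1 = a}).Subsingleton

/-- The disjointness graph of a family of sets in the plane: the vertices are the members of the
family, and two distinct members are adjacent if and only if they are disjoint. -/
def disjointnessGraph (F : Set (Set (ℝ × ℝ))) : SimpleGraph F where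
  Adj α β := α ≠ β ∧ Disjoint (α : Set (ℝ × ℝ)) (β : Set (ℝ × ℝ))
  symm := ⟨fun _ _ h => ⟨h.1.symm, h.2.symm⟩⟩
  loopless := ⟨fun _ h => h.1 rfl⟩

/-- `m` colors are enough to color properly every `K_{k+1}`-free disjointness graph of a family of
`x`-monotone curves. -/
def ColorsSuffice (k m : ℕ) : Prop :=
  ∀ F : Set (Set (ℝ × ℝ)), (∀ C ∈ F, IsXMonotoneCurve C) →
    (disjointnessGraph F).CliqueFree (k + 1) → (disjointnessGraph F).Colorable m

/-- `m` colors are enough to color properly every `K_{k+1}`-free disjointness graph of a finite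
family of `x`-monotone curves. -/
def ColorsSufficeFinite (k m : ℕ) : Prop :=
  ∀ F : Set (Set (ℝ × ℝ)), F.Finite → (∀ C ∈ F, IsXMonotoneCurve C) →
    (disjointnessGraph F).CliqueFree (k + 1) → (disjointnessGraph F).Colorable m

/-! An x-monotone curve is the graph of a continuous function on a compact interval, so two such
curves are disjoint exactly when one lies below the other over the common part of their intervals.

Upper bound. Two intervals are either staggered or nested. Combined with below or above, this gives
four transitive relations that cover all disjoint pairs. Ranking every curve by the largest clique
above it in each relation (`exists_clique_rank`) gives four numbers below `k` that together form a
proper coloring. The two nested ranks of a curve have sum less than `k`, since the corresponding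
cliques and the curve itself form one clique; hence `k ^ 2 * (k + 1).choose 2` colors.

Lower bound. Take a digraph with unique directed paths whose chromatic number is at least the number
of types `(a, d, f, g)`, and give the vertices of each level one type. A type prescribes a rank to
the right and a rank to the left. `exists_xMonotoneCurves` draws the digraph so that arcs become
disjoint pairs, while disjoint curves are joined by a path on which neither rank drops below both
ends. A clique then lies on one directed path, along which both ranks rise to a peak and fall
afterwards. The types are ordered so that `a` increases before the first peak, `f` or `g` increases
between the peaks and `d` decreases after the second. As `a ≤ f, g ≤ k - 1 - d`, the clique injects
into `k` values (`card_le_of_bimonotone`). -/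

/-! ### Curves as graphs of functions -/

/-- The part over `[a, b]` of the graph of a real function. -/
def graphOver (f : ℝ → ℝ) (a b : ℝ) : Set (ℝ × ℝ) :=
  (fun x => (x, f x)) '' Set.Icc a b

theorem IsXMonotoneCurve.exists_eq_graphOver {C : Set (ℝ × ℝ)} (hC : IsXMonotoneCurve C) :
    ∃ (a b : ℝ) (f : ℝ → ℝ), a ≤ b ∧ ContinuousOn f (Set.Icc a b) ∧ C = graphOver f a b := by
  obtain ⟨⟨φ, hφ, rfl⟩, hmono⟩ := hC
  set p : unitInterval → ℝ := fun s => (φ s).1 with hp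
  have hpc : Continuous p := continuous_fst.comp hφ
  have hconn : IsPreconnected (Set.range p) := isPreconnected_range hpc
  have hcomp : IsCompact (Set.range p) := isCompact_range hpc
  have hne : (Set.range p).Nonempty := Set.range_nonempty p
  have hrange : Set.range p = Set.Icc (sInf (Set.range p)) (sSup (Set.range p)) :=
    eq_Icc_of_connected_compact ⟨hne, hconn⟩ hcomp
  set a := sInf (Set.range p)
  set b := sSup (Set.range p)
  have hab : a ≤ b := by
    rw [hrange] at hne
    exact Set.nonempty_Icc.mp hne
  let q : unitInterval → Set.Icc a b := fun s => ⟨p s, hrange ▸ Set.mem_range_self s⟩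
  have hqc : Continuous q := hpc.subtype_mk _
  have hqs : Function.Surjective q := by
    rintro ⟨x, hx⟩
    rw [← hrange] at hx
    obtain ⟨s, hs⟩ := hx
    exact ⟨s, Subtype.ext hs⟩
  -- The section `Function.surjInv` need not be continuous, but `q` is a closed surjection (compact
  -- to Hausdorff), so continuity of the height may be tested after composing with `q`.
  have hquot : Topology.IsQuotientMap q := hqc.isClosedMap.isQuotientMap hqc hqs
  let y : Set.Icc a b → ℝ := fun x => (φ (Function.surjInv hqs x)).2
  have hφy : ∀ s, φ s = (p s, y (q s)) := by
    intro s
    have h1 : p (Function.surjInv hqs (q s)) = p s :=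
      congrArg Subtype.val (Function.surjInv_eq hqs (q s))
    have h2 : φ (Function.surjInv hqs (q s)) = φ s :=
      hmono (p s) ⟨⟨_, rfl⟩, h1⟩ ⟨⟨_, rfl⟩, rfl⟩
    exact Prod.ext rfl (congrArg Prod.snd h2).symm
  have hyc : Continuous y := by
    rw [hquot.continuous_iff]
    have : y ∘ q = fun s => (φ s).2 := by
      funext s
      rw [hφy s]
      rfl
    rw [this]
    exact continuous_snd.comp hφ
  refine ⟨a, b, Set.IccExtend hab y, hab, (hyc.Icc_extend').continuousOn, ?_⟩
  ext z
  constructor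
  · rintro ⟨s, rfl⟩
    refine ⟨p s, (q s).2, ?_⟩
    rw [hφy s]
    exact Prod.ext rfl (Set.IccExtend_of_mem hab y (q s).2)
  · rintro ⟨x, hx, rfl⟩
    obtain ⟨s, hs⟩ := hqs ⟨x, hx⟩
    refine ⟨s, ?_⟩
    rw [hφy s, hs]
    exact Prod.ext (congrArg Subtype.val hs) (Set.IccExtend_of_mem hab y hx).symm

theorem isXMonotoneCurve_graphOver {f : ℝ → ℝ} (hf : Continuous f) {a b : ℝ} (hab : a < b) :
    IsXMonotoneCurve (graphOver f a b) := by
  refine ⟨⟨fun s => (((iccHomeoI a b hab).symm s : ℝ), f ((iccHomeoI a b hab).symm s)),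
    by fun_prop, ?_⟩, ?_⟩
  · ext z
    constructor
    · rintro ⟨s, rfl⟩
      exact ⟨_, ((iccHomeoI a b hab).symm s).2, rfl⟩
    · rintro ⟨x, hx, rfl⟩
      exact ⟨iccHomeoI a b hab ⟨x, hx⟩, by simp⟩
  · rintro c _ ⟨⟨x, -, rfl⟩, rfl : x = c⟩ _ ⟨⟨y, -, rfl⟩, hy⟩
    obtain rfl : y = x := hy
    rfl

/-- Over the common part of `[a, b]` and `[a', b']`, the function `f` lies strictly below `g`. -/
def BelowOn (f : ℝ → ℝ) (a b : ℝ) (g : ℝ → ℝ) (a' b' : ℝ) : Prop :=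
  ∀ x ∈ Set.Icc a b ∩ Set.Icc a' b', f x < g x

/-- Intermediate value theorem on the common interval. When the intervals do not meet, both
alternatives hold vacuously. -/
theorem disjoint_graphOver_iff {f g : ℝ → ℝ} {a b a' b' : ℝ}
    (hf : ContinuousOn f (Set.Icc a b)) (hg : ContinuousOn g (Set.Icc a' b')) :
    Disjoint (graphOver f a b) (graphOver g a' b') ↔
      BelowOn f a b g a' b' ∨ BelowOn g a' b' f a b := by
  have key : Disjoint (graphOver f a b) (graphOver g a' b') ↔
      ∀ x ∈ Set.Icc a b ∩ Set.Icc a' b', f x ≠ g x := by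
    rw [Set.disjoint_left]
    constructor
    · rintro h x ⟨hx, hx'⟩ he
      exact h ⟨x, hx, rfl⟩ ⟨x, hx', Prod.ext rfl he.symm⟩
    · rintro h _ ⟨x, hx, rfl⟩ ⟨y, hy, he⟩
      obtain rfl : y = x := congrArg Prod.fst he
      exact h y ⟨hx, hy⟩ (congrArg Prod.snd he).symm
  rw [key]
  constructor
  · intro h
    by_contra! hcon
    obtain ⟨h1, h2⟩ := hcon
    simp only [BelowOn] at h1 h2
    push Not at h1 h2
    obtain ⟨x, hx, hx'⟩ := h1
    obtain ⟨y, hy, hy'⟩ := h2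
    have hpre : IsPreconnected (Set.Icc a b ∩ Set.Icc a' b') := by
      rw [Set.Icc_inter_Icc]
      exact isPreconnected_Icc
    obtain ⟨z, hz, hz'⟩ := hpre.intermediate_value₂ (f := f) (g := g) ⟨hy.2, hy.1⟩ hx
      (hf.mono Set.inter_subset_left) (hg.mono Set.inter_subset_right) hy' hx'
    exact h z hz hz'
  · rintro (h | h) x hx
    · exact (h x hx).ne
    · exact (h x hx.symm).ne'

/-! ### Upper bound -/

/-- For a transitive relation `lt` contained in the adjacency of a `K_{k+1}`-free graph, the
largest cardinality `g v` of a clique among the elements above `v`. -/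
theorem exists_clique_rank {V : Type*} {G : SimpleGraph V} {k : ℕ} (hG : G.CliqueFree (k + 1))
    {lt : V → V → Prop} (htrans : ∀ u v w, lt u v → lt v w → lt u w)
    (hadj : ∀ u v, lt u v → G.Adj u v) :
    ∃ g : V → ℕ, (∀ v, ∃ S : Finset V, G.IsClique S ∧ (∀ w ∈ S, lt v w) ∧ S.card = g v) ∧
      (∀ v, g v < k) ∧ ∀ u v, lt u v → g v < g u := by
  classical
  have hins : ∀ v (S : Finset V), G.IsClique S → (∀ w ∈ S, lt v w) →
      G.IsClique (insert v S : Finset V) ∧ (insert v S : Finset V).card = S.card + 1 := by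
    intro v S hS hv
    constructor
    · rw [Finset.coe_insert]
      exact hS.insert fun w hw _ => hadj _ _ (hv w hw)
    · exact Finset.card_insert_of_notMem fun h => (hadj _ _ (hv v h)).ne rfl
  have hbd : ∀ S : Finset V, G.IsClique S → S.card ≤ k := by
    intro S hS
    by_contra! hlt
    obtain ⟨S', hS', hc⟩ := Finset.exists_subset_card_eq (Nat.succ_le_of_lt hlt)
    exact hG S' ⟨hS.subset (by exact_mod_cast hS'), hc⟩
  let P : V → ℕ → Prop := fun v n =>
    ∃ S : Finset V, G.IsClique S ∧ (∀ w ∈ S, lt v w) ∧ S.card = n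
  let g : V → ℕ := fun v => Nat.findGreatest (P v) k
  have hspec : ∀ v, P v (g v) := fun v =>
    Nat.findGreatest_spec (P := P v) (Nat.zero_le k) ⟨∅, by simp, by simp, rfl⟩
  refine ⟨g, hspec, fun v => ?_, fun u v huv => ?_⟩
  -- Adding `v` to a largest clique above it gives a clique with `g v + 1` members. By transitivity
  -- that clique lies above every `u` with `lt u v`, which gives the strict decrease below.
  · obtain ⟨S, hS, hv, hc⟩ := hspec v
    obtain ⟨h1, h2⟩ := hins v S hS hv
    have := hbd _ h1
    omega
  · obtain ⟨S, hS, hv, hc⟩ := hspec v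
    obtain ⟨h1, h2⟩ := hins v S hS hv
    have hle : g v + 1 ≤ k := by
      have := hbd _ h1
      omega
    refine Nat.le_findGreatest hle ⟨insert v S, h1, ?_, by omega⟩
    intro w hw
    rcases Finset.mem_insert.mp hw with rfl | hw
    · exact huv
    · exact htrans _ _ _ huv (hv w hw)

theorem card_filter_add_lt (k : ℕ) :
    ((Finset.range k ×ˢ Finset.range k).filter fun p => p.1 + p.2 < k).card
      = (k + 1).choose 2 := by
  have h : ((Finset.range k ×ˢ Finset.range k).filter fun p => p.1 + p.2 < k)
      = (Finset.range k).biUnion fun n => Finset.HasAntidiagonal.antidiagonal n := by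
    ext ⟨i, j⟩
    simp only [Finset.mem_filter, Finset.mem_product, Finset.mem_range, Finset.mem_biUnion,
      Finset.HasAntidiagonal.mem_antidiagonal]
    constructor
    · rintro ⟨-, h⟩
      exact ⟨_, h, rfl⟩
    · rintro ⟨n, hn, rfl⟩
      omega
  rw [h, Finset.card_biUnion]
  · simp only [Finset.Nat.card_antidiagonal]
    have hs := Finset.sum_range_succ' (fun i => i) k
    rw [add_zero] at hs
    rw [← hs, Finset.sum_range_id, Nat.choose_two_right]
  · intro m _ n _ hmn
    rw [Function.onFun, Finset.disjoint_left]
    rintro ⟨i, j⟩ h1 h2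
    rw [Finset.HasAntidiagonal.mem_antidiagonal] at h1 h2
    exact hmn (h1.symm.trans h2)

theorem colorsSuffice_sq_mul_choose (k : ℕ) : ColorsSuffice k (k ^ 2 * (k + 1).choose 2) := by
  classical
  intro F hF hfree
  choose a b f hab hf hC using fun C : F => (hF C C.2).exists_eq_graphOver
  set G := disjointnessGraph F
  let below : F → F → Prop := fun C D => BelowOn (f C) (a C) (b C) (f D) (a D) (b D)
  have hirr : ∀ C, ¬ below C C := fun C h =>
    lt_irrefl _ (h (a C) ⟨Set.left_mem_Icc.mpr (hab C), Set.left_mem_Icc.mpr (hab C)⟩)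
  have hadj_iff : ∀ C D, G.Adj C D ↔ below C D ∨ below D C := by
    intro C D
    have hd : Disjoint (C : Set (ℝ × ℝ)) D ↔ below C D ∨ below D C := by
      rw [hC C, hC D]
      exact disjoint_graphOver_iff (hf C) (hf D)
    refine ⟨fun h => hd.mp h.2, fun h => ⟨?_, hd.mpr h⟩⟩
    rintro rfl
    exact hirr C (h.elim id id)
  -- Being below is not transitive by itself. In all four relations the common part of the outer two
  -- intervals lies in the middle one, which restores transitivity.
  obtain ⟨g₁, -, hg₁, hlt₁⟩ := exists_clique_rank hfree
    (lt := fun C D => a C ≤ a D ∧ b C ≤ b D ∧ below C D)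
    (fun C D E h h' => ⟨h.1.trans h'.1, h.2.1.trans h'.2.1, fun x hx =>
      (h.2.2 x ⟨hx.1, h'.1.trans hx.2.1, hx.1.2.trans h.2.1⟩).trans
      (h'.2.2 x ⟨⟨h'.1.trans hx.2.1, hx.1.2.trans h.2.1⟩, hx.2⟩)⟩)
    (fun C D h => (hadj_iff C D).mpr (Or.inl h.2.2))
  obtain ⟨g₂, -, hg₂, hlt₂⟩ := exists_clique_rank hfree
    (lt := fun C D => a C ≤ a D ∧ b C ≤ b D ∧ below D C)
    (fun C D E h h' => ⟨h.1.trans h'.1, h.2.1.trans h'.2.1, fun x hx =>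
      (h'.2.2 x ⟨hx.1, h'.1.trans hx.1.1, hx.2.2.trans h.2.1⟩).trans
      (h.2.2 x ⟨⟨h'.1.trans hx.1.1, hx.2.2.trans h.2.1⟩, hx.2⟩)⟩)
    (fun C D h => (hadj_iff C D).mpr (Or.inr h.2.2))
  obtain ⟨g₃, hS₃, hg₃, hlt₃⟩ := exists_clique_rank hfree
    (lt := fun C D => a C ≤ a D ∧ b D ≤ b C ∧ below C D)
    (fun C D E h h' => ⟨h.1.trans h'.1, h'.2.1.trans h.2.1, fun x hx =>
      (h.2.2 x ⟨hx.1, h'.1.trans hx.2.1, hx.2.2.trans h'.2.1⟩).trans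
      (h'.2.2 x ⟨⟨h'.1.trans hx.2.1, hx.2.2.trans h'.2.1⟩, hx.2⟩)⟩)
    (fun C D h => (hadj_iff C D).mpr (Or.inl h.2.2))
  obtain ⟨g₄, hS₄, hg₄, hlt₄⟩ := exists_clique_rank hfree
    (lt := fun C D => a C ≤ a D ∧ b D ≤ b C ∧ below D C)
    (fun C D E h h' => ⟨h.1.trans h'.1, h'.2.1.trans h.2.1, fun x hx =>
      (h'.2.2 x ⟨hx.1, h'.1.trans hx.1.1, hx.1.2.trans h'.2.1⟩).trans
      (h.2.2 x ⟨⟨h'.1.trans hx.1.1, hx.1.2.trans h'.2.1⟩, hx.2⟩)⟩)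
    (fun C D h => (hadj_iff C D).mpr (Or.inr h.2.2))
  -- The intervals of all members of `S` and `T` lie inside that of `C`, so `C` separates `T` below
  -- from `S` above, and `S`, `T` and `C` form one clique.
  have hsum : ∀ C, g₃ C + g₄ C < k := by
    intro C
    obtain ⟨S, hS, hCS, hcS⟩ := hS₃ C
    obtain ⟨T, hT, hCT, hcT⟩ := hS₄ C
    have hST : ∀ D ∈ S, ∀ E ∈ T, G.Adj D E := by
      intro D hD E hE
      obtain ⟨h1, h2, h3⟩ := hCS D hD
      obtain ⟨h1', h2', h3'⟩ := hCT E hE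
      refine (hadj_iff D E).mpr (Or.inr fun x hx => ?_)
      have hx' : x ∈ Set.Icc (a C) (b C) := ⟨h1.trans hx.2.1, hx.2.2.trans h2⟩
      exact (h3' x ⟨hx.1, hx'⟩).trans (h3 x ⟨hx', hx.2⟩)
    have hdisj : Disjoint S T := Finset.disjoint_left.mpr fun D hD hD' => (hST D hD D hD').ne rfl
    have hCn : C ∉ S ∪ T := by
      rw [Finset.mem_union]
      rintro (h | h)
      · exact hirr C (hCS C h).2.2
      · exact hirr C (hCT C h).2.2
    have hclique : G.IsClique (insert C (S ∪ T) : Finset F) := by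
      rw [Finset.coe_insert, Finset.coe_union]
      refine SimpleGraph.IsClique.insert ?_ ?_
      · intro D hD E hE hne
        rcases hD with hD | hD <;> rcases hE with hE | hE
        · exact hS hD hE hne
        · exact hST D hD E hE
        · exact (hST E hE D hD).symm
        · exact hT hD hE hne
      · rintro D (hD | hD) -
        · exact (hadj_iff C D).mpr (Or.inl (hCS D hD).2.2)
        · exact (hadj_iff C D).mpr (Or.inr (hCT D hD).2.2)
    have hcard : (insert C (S ∪ T)).card = g₃ C + g₄ C + 1 := by
      rw [Finset.card_insert_of_notMem hCn, Finset.card_union_of_disjoint hdisj, hcS, hcT]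
    by_contra! hlt
    obtain ⟨S', hS', hc⟩ := Finset.exists_subset_card_eq
      (show k + 1 ≤ (insert C (S ∪ T)).card by omega)
    exact hfree S' ⟨hclique.subset (by exact_mod_cast hS'), hc⟩
  let K : Finset ((ℕ × ℕ) × (ℕ × ℕ)) := (Finset.range k ×ˢ Finset.range k) ×ˢ
    ((Finset.range k ×ˢ Finset.range k).filter fun p => p.1 + p.2 < k)
  have hK : Fintype.card K = k ^ 2 * (k + 1).choose 2 := by
    rw [Fintype.card_coe, Finset.card_product, card_filter_add_lt, Finset.card_product,
      Finset.card_range, sq]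
  rw [← hK]
  have hmem : ∀ C, ((g₁ C, g₂ C), (g₃ C, g₄ C)) ∈ K := by
    intro C
    simp only [K, Finset.mem_product, Finset.mem_filter, Finset.mem_range]
    exact ⟨⟨hg₁ C, hg₂ C⟩, ⟨hg₃ C, hg₄ C⟩, hsum C⟩
  refine (SimpleGraph.Coloring.mk (fun C => (⟨_, hmem C⟩ : K)) ?_).colorable
  intro C D hadj heq
  simp only [Subtype.mk.injEq, Prod.mk.injEq] at heq
  obtain ⟨⟨e1, e2⟩, e3, e4⟩ := heq
  have hcases := (hadj_iff C D).mp hadj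
  rcases le_total (a C) (a D) with ha | ha <;> rcases le_total (b C) (b D) with hb | hb <;>
    rcases hcases with h | h
  · exact (hlt₁ C D ⟨ha, hb, h⟩).ne' e1
  · exact (hlt₂ C D ⟨ha, hb, h⟩).ne' e2
  · exact (hlt₃ C D ⟨ha, hb, h⟩).ne' e3
  · exact (hlt₄ C D ⟨ha, hb, h⟩).ne' e4
  · exact (hlt₄ D C ⟨ha, hb, h⟩).ne e4
  · exact (hlt₃ D C ⟨ha, hb, h⟩).ne e3
  · exact (hlt₂ D C ⟨ha, hb, h⟩).ne e2
  · exact (hlt₁ D C ⟨ha, hb, h⟩).ne e1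

/-! ### Reduction to finite families -/

/-- De Bruijn–Erdős compactness: colorings of the finite subgraphs suffice, and a finite subfamily
inherits the absence of large cliques. -/
theorem colorsSuffice_iff_colorsSufficeFinite (k m : ℕ) :
    ColorsSuffice k m ↔ ColorsSufficeFinite k m := by
  refine ⟨fun h F _ hF hfree => h F hF hfree, fun h F hF hfree => ?_⟩
  refine SimpleGraph.nonempty_hom_of_forall_finite_subgraph_hom fun G' hG' => ?_
  let F' : Set (Set (ℝ × ℝ)) := Subtype.val '' G'.verts
  have hsub : F' ⊆ F := by
    rintro _ ⟨C, -, rfl⟩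
    exact C.2
  let ι : disjointnessGraph F' ↪g disjointnessGraph F :=
    { toFun := Set.inclusion hsub
      inj' := Set.inclusion_injective hsub
      map_rel_iff' := by
        intro C D
        simp [disjointnessGraph, Subtype.ext_iff] }
  have hcol := h F' (hG'.image _) (fun C hC => hF C (hsub hC)) (hfree.comap ⟨ι.toCopy⟩)
  refine hcol.some.comp ⟨fun v => ⟨v.1.1, v.1, v.2, rfl⟩, fun {u v} huv => ?_⟩
  have hadj := G'.adj_sub huv
  exact ⟨fun he => hadj.ne (Subtype.ext (congrArg (fun C : F' => (C : Set (ℝ × ℝ))) he)), hadj.2⟩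

/-! ### Digraphs with unique paths and large chromatic number -/

/-- There is a directed path from `u` to `w` along `Arc`, all of whose vertices satisfy `S`. -/
def ReachWithin {V : Type*} (Arc : V → V → Prop) (S : V → Prop) (u w : V) : Prop :=
  S u ∧ Relation.ReflTransGen (fun a b => Arc a b ∧ S b) u w

theorem ReachWithin.right {V : Type*} {Arc : V → V → Prop} {S : V → Prop} {u w : V}
    (h : ReachWithin Arc S u w) : S w := by
  rcases h.2.cases_tail with h' | ⟨c, -, h'⟩
  · exact h' ▸ h.1
  · exact h'.2

theorem ReachWithin.mono {V : Type*} {Arc : V → V → Prop} {S S' : V → Prop} {u w : V}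
    (h : ReachWithin Arc S u w) (hS : ∀ x, S x → S' x) : ReachWithin Arc S' u w :=
  ⟨hS _ h.1, Relation.ReflTransGen.mono (fun _ _ h => ⟨h.1, hS _ h.2⟩) _ _ h.2⟩

/-- Arcs of the Zykov-type extension of a digraph: `m` disjoint copies of the digraph and, for
every choice of one vertex in each copy, a new vertex that is the head of an arc from each chosen
vertex. -/
def zykovArc {V : Type*} (m : ℕ) (Arc : V → V → Prop) :
    (Fin m × V) ⊕ (Fin m → V) → (Fin m × V) ⊕ (Fin m → V) → Prop
  | .inl p, .inl q => p.1 = q.1 ∧ Arc p.2 q.2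
  | .inl p, .inr f => f p.1 = p.2
  | .inr _, _ => False

theorem reachWithin_zykovArc_inl {V : Type*} {m : ℕ} {Arc : V → V → Prop}
    {S : (Fin m × V) ⊕ (Fin m → V) → Prop} {i : Fin m} {u : V} {x : (Fin m × V) ⊕ (Fin m → V)}
    (h : ReachWithin (zykovArc m Arc) S (.inl (i, u)) x) :
    match x with
    | .inl p => p.1 = i ∧ ReachWithin Arc (fun v => S (.inl (i, v))) u p.2
    | .inr f => ReachWithin Arc (fun v => S (.inl (i, v))) u (f i) := by
  obtain ⟨hu, h⟩ := h
  induction h with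
  | refl => exact ⟨rfl, hu, .refl⟩
  | @tail x y _ hxy ih =>
    rcases x with ⟨j, x⟩ | f
    · obtain ⟨rfl : j = i, ih⟩ := ih
      rcases y with ⟨j', y⟩ | f
      · obtain ⟨⟨rfl : j = j', h⟩, hS⟩ := hxy
        exact ⟨rfl, ih.1, ih.2.tail ⟨h, hS⟩⟩
      · obtain ⟨h : f j = x, -⟩ := hxy
        simpa [h] using ih
    · exact hxy.1.elim

theorem reachWithin_zykovArc_inr {V : Type*} {m : ℕ} {Arc : V → V → Prop}
    {S : (Fin m × V) ⊕ (Fin m → V) → Prop} {f : Fin m → V} {x : (Fin m × V) ⊕ (Fin m → V)}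
    (h : ReachWithin (zykovArc m Arc) S (.inr f) x) : x = .inr f := by
  rcases h.2.cases_head with h | ⟨c, h, -⟩
  · exact h.symm
  · exact h.1.elim

/-- For every `m` there is a finite digraph whose vertices have levels `< m`, whose arcs go from
smaller to larger levels, in which the directed path between two vertices is unique, and every
proper colouring of which uses at least `m` colours. -/
theorem exists_unipathic_digraph (m : ℕ) :
    ∃ (V : Type) (_ : Fintype V) (Arc : V → V → Prop) (lev : V → ℕ),
      (∀ v, lev v < m) ∧ (∀ u v, Arc u v → lev u < lev v) ∧
      (∀ (S : V → Prop) (u v w : V), ReachWithin Arc (fun _ => True) u v →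
        ReachWithin Arc (fun _ => True) v w → ReachWithin Arc S u w → S v) ∧
      ∀ col : V → ℕ, (∀ u v, Arc u v → col u ≠ col v) → m ≤ (Finset.univ.image col).card := by
  induction m with
  | zero =>
    exact ⟨Empty, inferInstance, fun _ _ => False, fun _ => 0, fun v => v.elim,
      fun v => v.elim, fun _ v => v.elim, fun _ _ => Nat.zero_le _⟩
  | succ m ih =>
    classical
    obtain ⟨V, _, Arc, lev, hlev, harc, huniq, hcol⟩ := ih
    refine ⟨(Fin m × V) ⊕ (Fin m → V), inferInstance, zykovArc m Arc,
      Sum.elim (fun p => lev p.2) (fun _ => m), ?_, ?_, ?_, ?_⟩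
    · rintro (p | f)
      · exact (hlev p.2).trans (Nat.lt_succ_self m)
      · exact Nat.lt_succ_self m
    · rintro (p | f) (q | g) h
      · exact harc _ _ h.2
      · exact hlev p.2
      · exact h.elim
      · exact h.elim
    -- Uniqueness is expressed thus: a path from `u` to `w` meets every vertex that lies on some
    -- path from `u` to `w`. New vertices are sinks with one in-neighbor per copy, so a path
    -- starting in a copy stays there, except perhaps for its last vertex.
    · rintro S (⟨i, u⟩ | f) v w huv hvw huw
      · rcases v with ⟨j, v⟩ | f
        · obtain ⟨rfl : j = i, huv'⟩ := reachWithin_zykovArc_inl huv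
          rcases w with ⟨l, w⟩ | f
          · obtain ⟨rfl : l = j, hvw'⟩ := reachWithin_zykovArc_inl hvw
            exact huniq _ u v w huv' hvw' (reachWithin_zykovArc_inl huw).2
          · exact huniq _ u v (f j) huv' (reachWithin_zykovArc_inl hvw)
              (reachWithin_zykovArc_inl huw)
        · obtain rfl := reachWithin_zykovArc_inr hvw
          exact huw.right
      · obtain rfl := reachWithin_zykovArc_inr huv
        exact huw.1
    · intro col hproper
      by_contra! hlt
      set R := Finset.univ.image col
      -- With at most `m` colors in total, every copy uses all of `R`. Choosing in copy `i` a vertex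
      -- of the `i`-th color leaves no color for the corresponding new vertex.
      have himage : ∀ i : Fin m, (Finset.univ.image fun v => col (.inl (i, v))) = R ∧
          R.card = m := by
        intro i
        have h1 := hcol (fun v => col (.inl (i, v))) fun u v h => hproper _ _ ⟨rfl, h⟩
        have h2 : (Finset.univ.image fun v => col (.inl (i, v))) ⊆ R := by
          intro c hc
          obtain ⟨v, -, rfl⟩ := Finset.mem_image.mp hc
          exact Finset.mem_image_of_mem _ (Finset.mem_univ _)
        have h3 := Finset.card_le_card h2
        exact ⟨Finset.eq_of_subset_of_card_le h2 (by omega), by omega⟩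
      have hRcard : R.card ≤ m := by omega
      obtain ⟨e, he⟩ : ∃ e : Fin m → ℕ, ∀ c ∈ R, ∃ i, e i = c := by
        refine ⟨fun i => if h : (i : ℕ) < R.card then R.equivFin.symm ⟨i, h⟩ else 0, ?_⟩
        intro c hc
        have hlt' := (R.equivFin ⟨c, hc⟩).2
        refine ⟨⟨R.equivFin ⟨c, hc⟩, hlt'.trans_le hRcard⟩, ?_⟩
        simp
      have hex : ∀ i : Fin m, ∃ v, e i ∈ R → col (.inl (i, v)) = e i := by
        intro i
        by_cases hei : e i ∈ R
        · have := hei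
          rw [← (himage i).1] at this
          obtain ⟨v, -, hv⟩ := Finset.mem_image.mp this
          exact ⟨v, fun _ => hv⟩
        · have : Nonempty V := by
            have h1 := himage i
            by_contra hempty
            rw [not_nonempty_iff] at hempty
            have : R = ∅ := by rw [← h1.1]; simp
            rw [this, Finset.card_empty] at h1
            exact absurd i.2 (by omega)
          exact ⟨this.some, fun h => (hei h).elim⟩
      choose f hf using hex
      have hmem : col (.inr f) ∈ R := Finset.mem_image_of_mem _ (Finset.mem_univ _)
      obtain ⟨i, hi⟩ := he _ hmem
      exact hproper (.inl (i, f i)) (.inr f) rfl ((hf i (hi ▸ hmem)).trans hi)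

/-! ### Realization by curves -/

/-- A sequence of height functions for the vertices of a finite digraph, the vertex `v` being alive
at the times `n ≤ R v`: arcs between alive vertices are respected at all times, and two vertices
without a directed path through vertices of rank at least `min (r u) (r w)` get the same height at
some time. -/
theorem exists_height_sequence {V : Type} [Fintype V] (Arc : V → V → Prop) (lev r : V → ℕ)
    (hlev : ∀ u v, Arc u v → lev u < lev v) :
    ∃ (H : ℕ → V → ℝ) (R : V → ℕ),
      (∀ n u v, Arc u v → n ≤ R u → n ≤ R v → H n u < H n v) ∧
      ∀ u w, lev u ≤ lev w → ¬ ReachWithin Arc (fun x => min (r u) (r w) ≤ r x) u w →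
        ∃ n, n ≤ R u ∧ n ≤ R w ∧ H n u = H n w := by
  classical
  rcases isEmpty_or_nonempty V with hV | hV
  · exact ⟨fun _ _ => 0, fun _ => 0, fun _ u => hV.elim u, fun u => hV.elim u⟩
  set N := Fintype.card (V × V) with hN
  have hNpos : 0 < N := Fintype.card_pos
  let e : V × V ≃ Fin N := Fintype.equivFin _
  let pair : ℕ → V × V := fun n => e.symm ⟨n % N, Nat.mod_lt _ hNpos⟩
  -- The time `n` encodes a threshold `n / N` and a pair `n % N`. Everything reachable from the
  -- first vertex of the pair through vertices of rank at least the threshold is lifted by the level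
  -- difference. This set is closed under arcs between alive vertices, so their order survives; if
  -- the second vertex is not reached, the first is lifted exactly to its height.
  let shift : ℕ → V → ℝ := fun n x =>
    if ReachWithin Arc (fun y => n / N ≤ r y) (pair n).1 x ∧ lev (pair n).1 ≤ lev (pair n).2 then
      (lev (pair n).2 : ℝ) - lev (pair n).1 else 0
  have halive : ∀ n v, n ≤ r v * N + (N - 1) ↔ n / N ≤ r v := by
    intro n v
    rw [← Nat.lt_succ_iff (n := r v), Nat.div_lt_iff_lt_mul hNpos, Nat.succ_mul]
    omega
  refine ⟨fun n x => lev x + shift n x, fun v => r v * N + (N - 1), ?_, ?_⟩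
  · intro n u v huv hu hv
    rw [halive] at hu hv
    have h1 : (lev u : ℝ) < lev v := by exact_mod_cast hlev u v huv
    have h2 : shift n u ≤ shift n v := by
      simp only [shift]
      split_ifs with hu' hv' hv'
      · exact le_rfl
      · exact (hv' ⟨⟨hu'.1.1, hu'.1.2.tail ⟨huv, hv⟩⟩, hu'.2⟩).elim
      · exact sub_nonneg.mpr (by exact_mod_cast hv'.2)
      · exact le_rfl
    exact add_lt_add_of_lt_of_le h1 h2
  · intro u w huw hnot
    set ρ := min (r u) (r w) with hρ
    let n := ρ * N + (e (u, w) : ℕ)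
    have hlt : (e (u, w) : ℕ) < N := (e (u, w)).2
    have hdiv : n / N = ρ := by
      rw [show n = e (u, w) + ρ * N from add_comm _ _, Nat.add_mul_div_right _ _ hNpos,
        Nat.div_eq_of_lt hlt, zero_add]
    have hmod : n % N = e (u, w) := by
      rw [show n = e (u, w) + ρ * N from add_comm _ _, Nat.add_mul_mod_self_right,
        Nat.mod_eq_of_lt hlt]
    have hpair : pair n = (u, w) := by
      simp only [pair, hmod, Fin.eta, Equiv.symm_apply_apply]
    refine ⟨n, (halive _ _).mpr (hdiv ▸ min_le_left _ _), (halive _ _).mpr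
      (hdiv ▸ min_le_right _ _), ?_⟩
    simp only [shift, hpair, hdiv]
    rw [if_pos ⟨⟨min_le_left _ _, .refl⟩, huw⟩, if_neg fun h => hnot h.1]
    ring

/-- Piecewise linear interpolation of the values of `H` at the integers in `[-M, M]`. -/
noncomputable def interpolate (M : ℕ) (H : ℤ → ℝ) (x : ℝ) : ℝ :=
  ∑ t ∈ Finset.Icc (-(M : ℤ)) M, H t * max 0 (1 - |x - t|)

theorem continuous_interpolate (M : ℕ) (H : ℤ → ℝ) : Continuous (interpolate M H) := by
  unfold interpolate
  fun_prop

theorem interpolate_intCast {M : ℕ} (H : ℤ → ℝ) {t : ℤ} (ht : t ∈ Finset.Icc (-(M : ℤ)) M) :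
    interpolate M H t = H t := by
  unfold interpolate
  rw [Finset.sum_eq_single_of_mem t ht]
  · simp
  · intro s _ hst
    have h1 : (1 : ℝ) ≤ |(t : ℝ) - s| := by
      have : (1 : ℤ) ≤ |t - s| := Int.one_le_abs (sub_ne_zero.mpr hst.symm)
      exact_mod_cast this
    rw [max_eq_left (by linarith), mul_zero]

/-- Only integers at distance less than 1 from `x` contribute. They lie in `[a, b]` because its ends
are integers, and `⌊x⌋` contributes strictly. -/
theorem interpolate_lt_interpolate {M : ℕ} {H K : ℤ → ℝ} {a b : ℤ} (ha : -(M : ℤ) ≤ a)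
    (hb : b ≤ M) (h : ∀ t, a ≤ t → t ≤ b → H t < K t) {x : ℝ} (hx : x ∈ Set.Icc (a : ℝ) b) :
    interpolate M H x < interpolate M K x := by
  have hrange : ∀ t : ℤ, |x - t| < 1 → a ≤ t ∧ t ≤ b := by
    intro t ht
    rw [abs_lt] at ht
    constructor
    · have : (a : ℝ) < t + 1 := by linarith [hx.1]
      exact Int.lt_add_one_iff.mp (by exact_mod_cast this)
    · have : (t : ℝ) < b + 1 := by linarith [hx.2]
      exact Int.lt_add_one_iff.mp (by exact_mod_cast this)
  have hfloor : |x - ⌊x⌋| < 1 := by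
    rw [Int.self_sub_floor, abs_of_nonneg (Int.fract_nonneg x)]
    exact Int.fract_lt_one x
  obtain ⟨h1, h2⟩ := hrange _ hfloor
  refine Finset.sum_lt_sum (fun t _ => ?_) ⟨⌊x⌋, Finset.mem_Icc.mpr ⟨by omega, by omega⟩, ?_⟩
  · rcases lt_or_ge |x - t| 1 with ht | ht
    · obtain ⟨h3, h4⟩ := hrange t ht
      exact mul_le_mul_of_nonneg_right (h t h3 h4).le (le_max_left _ _)
    · rw [max_eq_left (by linarith), mul_zero, mul_zero]
  · exact mul_lt_mul_of_pos_right (h _ h1 h2) (lt_max_of_lt_right (by linarith))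

/-- Realization of a digraph with two rank functions by `x`-monotone curves: arcs are realized by
disjoint curves, and disjoint curves are joined by directed paths on which the ranks do not drop
below those of both ends. -/
theorem exists_xMonotoneCurves {V : Type} [Fintype V] (Arc : V → V → Prop) (lev r l : V → ℕ)
    (hlev : ∀ u v, Arc u v → lev u < lev v) :
    ∃ γ : V → Set (ℝ × ℝ), (∀ v, IsXMonotoneCurve (γ v)) ∧
      (∀ u v, Arc u v → Disjoint (γ u) (γ v)) ∧
      ∀ u w, lev u ≤ lev w → Disjoint (γ u) (γ w) →
        ReachWithin Arc (fun x => min (r u) (r w) ≤ r x) u w ∧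
        ReachWithin Arc (fun x => min (l u) (l w) ≤ l x) u w := by
  obtain ⟨H, R, hH, hR⟩ := exists_height_sequence Arc lev r hlev
  obtain ⟨K, L, hK, hL⟩ := exists_height_sequence Arc lev l hlev
  -- The rank `r` is handled at abscissas `0, 1, 2, …` and `l` at `-1, -2, …`, so time `n` on the
  -- left sits at `-(n + 1)`.
  let h : V → ℤ → ℝ := fun v t => if 0 ≤ t then H t.toNat v else K ((-t).toNat - 1) v
  let M : ℕ := ∑ v, (R v + L v + 1)
  have hM : ∀ v, R v + L v + 1 ≤ M := fun v =>
    Finset.single_le_sum (f := fun v => R v + L v + 1) (fun _ _ => Nat.zero_le _)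
      (Finset.mem_univ v)
  let a : V → ℤ := fun v => -((L v : ℤ) + 1)
  let b : V → ℤ := fun v => R v
  let f : V → ℝ → ℝ := fun v => interpolate M (h v)
  have hcont : ∀ v, Continuous (f v) := fun v => continuous_interpolate _ _
  have hab : ∀ v, (a v : ℝ) < b v := fun v => by
    have : a v < b v := by simp only [a, b]; omega
    exact_mod_cast this
  have htouch : ∀ u w (t : ℤ), a u ≤ t → a w ≤ t → t ≤ b u → t ≤ b w → h u t = h w t →
      ¬ Disjoint (graphOver (f u) (a u) (b u)) (graphOver (f w) (a w) (b w)) := by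
    intro u w t h1 h2 h3 h4 he hd
    have ht : t ∈ Finset.Icc (-(M : ℤ)) M := by
      have := hM u
      simp only [a, b] at h1 h3
      exact Finset.mem_Icc.mpr ⟨by omega, by omega⟩
    refine Set.disjoint_left.mp hd ⟨t, ⟨by exact_mod_cast h1, by exact_mod_cast h3⟩, rfl⟩
      ⟨t, ⟨by exact_mod_cast h2, by exact_mod_cast h4⟩, ?_⟩
    simp only [f, interpolate_intCast _ ht, he]
  refine ⟨fun v => graphOver (f v) (a v) (b v),
    fun v => isXMonotoneCurve_graphOver (hcont v) (hab v), ?_, ?_⟩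
  · intro u v huv
    rw [disjoint_graphOver_iff (hcont u).continuousOn (hcont v).continuousOn]
    refine Or.inl fun x hx => ?_
    have hMu := hM u
    refine interpolate_lt_interpolate (a := max (a u) (a v)) (b := min (b u) (b v)) ?_ ?_ ?_ ?_
    · exact le_max_of_le_left (by simp only [a]; omega)
    · exact min_le_of_left_le (by simp only [b]; omega)
    · intro t h1 h2
      obtain ⟨h3, h4⟩ := max_le_iff.mp h1
      obtain ⟨h5, h6⟩ := le_min_iff.mp h2
      simp only [a, b] at h3 h4 h5 h6
      simp only [h]
      split_ifs with ht
      · exact hH _ _ _ huv (by omega) (by omega)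
      · exact hK _ _ _ huv (by omega) (by omega)
    · push_cast
      exact ⟨max_le hx.1.1 hx.2.1, le_min hx.1.2 hx.2.2⟩
  · intro u w huw hd
    constructor
    · by_contra hnot
      obtain ⟨n, hu, hw, he⟩ := hR u w huw hnot
      refine htouch u w n ?_ ?_ ?_ ?_ ?_ hd
      · simp only [a]; omega
      · simp only [a]; omega
      · simp only [b]; omega
      · simp only [b]; omega
      · simpa [h] using he
    · by_contra hnot
      obtain ⟨n, hu, hw, he⟩ := hL u w huw hnot
      refine htouch u w (-((n : ℤ) + 1)) ?_ ?_ ?_ ?_ ?_ hd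
      · simp only [a]; omega
      · simp only [a]; omega
      · simp only [b]; omega
      · simp only [b]; omega
      · have h1 : ¬ (0 : ℤ) ≤ -((n : ℤ) + 1) := by omega
        have h2 : (-(-((n : ℤ) + 1))).toNat - 1 = n := by omega
        simp only [h, if_neg h1, h2, he]

/-! ### Types, their orders and their number -/

theorem mul_add_lt_mul_add_iff {B e e' w w' : ℕ} (hw : w < B) (hw' : w' < B) :
    e * B + w < e' * B + w' ↔ e < e' ∨ e = e' ∧ w < w' := by
  rcases lt_trichotomy e e' with h | rfl | h
  · have := Nat.mul_le_mul_right B (Nat.succ_le_of_lt h)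
    rw [Nat.succ_mul] at this
    omega
  · omega
  · have := Nat.mul_le_mul_right B (Nat.succ_le_of_lt h)
    rw [Nat.succ_mul] at this
    omega

/-- The number with the digits `x, y, z, w` in base `B`. -/
def digits (B x y z w : ℕ) : ℕ := ((x * B + y) * B + z) * B + w

theorem digits_lt_digits_iff {B x y z w x' y' z' w' : ℕ} (hy : y < B) (hy' : y' < B)
    (hz : z < B) (hz' : z' < B) (hw : w < B) (hw' : w' < B) :
    digits B x y z w < digits B x' y' z' w' ↔
      x < x' ∨ x = x' ∧ (y < y' ∨ y = y' ∧ (z < z' ∨ z = z' ∧ w < w')) := by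
  have heq : ∀ {e e' v v' : ℕ}, v < B → v' < B →
      (e * B + v = e' * B + v' ↔ e = e' ∧ v = v') := by
    intro e e' v v' hv hv'
    have h1 := mul_add_lt_mul_add_iff (e := e) (e' := e') hv hv'
    have h2 := mul_add_lt_mul_add_iff (e := e') (e' := e) hv' hv
    constructor
    · intro h
      omega
    · rintro ⟨rfl, rfl⟩
      rfl
  unfold digits
  rw [mul_add_lt_mul_add_iff hw hw', mul_add_lt_mul_add_iff hz hz', mul_add_lt_mul_add_iff hy hy',
    heq hz hz', heq hy hy']
  omega

theorem card_le_of_bimonotone {ι : Type*} (S : Finset ι) (k : ℕ) (hgt r l a d f : ι → ℕ)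
    (hinj : ∀ x ∈ S, ∀ y ∈ S, x ≠ y → hgt x < hgt y ∨ hgt y < hgt x)
    (haf : ∀ x ∈ S, a x ≤ f x) (hfd : ∀ x ∈ S, f x + d x < k)
    (hr : ∀ x ∈ S, ∀ y ∈ S, ∀ z ∈ S, hgt x < hgt y → hgt y < hgt z → min (r x) (r z) ≤ r y)
    (hl : ∀ x ∈ S, ∀ y ∈ S, ∀ z ∈ S, hgt x < hgt y → hgt y < hgt z → min (l x) (l z) ≤ l y)
    (hrne : ∀ x ∈ S, ∀ y ∈ S, hgt x < hgt y → r x ≠ r y ∧ l x ≠ l y)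
    (ha : ∀ x ∈ S, ∀ y ∈ S, hgt x < hgt y → r x < r y → l x < l y → a x < a y)
    (hd : ∀ x ∈ S, ∀ y ∈ S, hgt x < hgt y → r y < r x → l y < l x → d y < d x)
    (hf : ∀ x ∈ S, ∀ y ∈ S, hgt x < hgt y → r y < r x → l x < l y → f x < f y)
    {p q : ι} (hp : p ∈ S) (hpmax : ∀ x ∈ S, r x ≤ r p) (hq : q ∈ S) (hqmax : ∀ x ∈ S, l x ≤ l q)
    (hpq : hgt p ≤ hgt q) : S.card ≤ k := by
  -- Betweenness with the peak `p` as one end, together with distinct ranks, makes `r` strictly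
  -- monotone on either side of `p`; likewise `l` around `q`.
  have rinc : ∀ x ∈ S, ∀ y ∈ S, hgt x < hgt y → hgt y ≤ hgt p → r x < r y := by
    intro x hx y hy hxy hyp
    have h1 := hrne x hx y hy hxy
    rcases hyp.lt_or_eq with h | h
    · have h2 := hr x hx y hy p hp hxy h
      have h3 := hpmax y hy
      have h4 := hrne y hy p hp h
      omega
    · obtain rfl : y = p := by
        by_contra hne
        have := hinj y hy p hp hne
        omega
      have := hpmax x hx
      omega
  have linc : ∀ x ∈ S, ∀ y ∈ S, hgt x < hgt y → hgt y ≤ hgt q → l x < l y := by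
    intro x hx y hy hxy hyq
    have h1 := hrne x hx y hy hxy
    rcases hyq.lt_or_eq with h | h
    · have h2 := hl x hx y hy q hq hxy h
      have h3 := hqmax y hy
      have h4 := hrne y hy q hq h
      omega
    · obtain rfl : y = q := by
        by_contra hne
        have := hinj y hy q hq hne
        omega
      have := hqmax x hx
      omega
  have rdec : ∀ x ∈ S, ∀ y ∈ S, hgt x < hgt y → hgt p ≤ hgt x → r y < r x := by
    intro x hx y hy hxy hpx
    have h1 := hrne x hx y hy hxy
    rcases hpx.lt_or_eq with h | h
    · have h2 := hr p hp x hx y hy h hxy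
      have h3 := hpmax x hx
      have h4 := hrne p hp x hx h
      omega
    · obtain rfl : x = p := by
        by_contra hne
        have := hinj x hx p hp hne
        omega
      have := hpmax y hy
      omega
  have ldec : ∀ x ∈ S, ∀ y ∈ S, hgt x < hgt y → hgt q ≤ hgt x → l y < l x := by
    intro x hx y hy hxy hqx
    have h1 := hrne x hx y hy hxy
    rcases hqx.lt_or_eq with h | h
    · have h2 := hl q hq x hx y hy h hxy
      have h3 := hqmax x hx
      have h4 := hrne q hq x hx h
      omega
    · obtain rfl : x = q := by
        by_contra hne
        have := hinj x hx q hq hne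
        omega
      have := hqmax y hy
      omega
  have up : ∀ x ∈ S, ∀ y ∈ S, hgt x < hgt y → hgt y ≤ hgt p → a x < a y := fun x hx y hy h h' =>
    ha x hx y hy h (rinc x hx y hy h h') (linc x hx y hy h (h'.trans hpq))
  have mid : ∀ x ∈ S, ∀ y ∈ S, hgt x < hgt y → hgt p ≤ hgt x → hgt y ≤ hgt q → f x < f y :=
    fun x hx y hy h h' h'' => hf x hx y hy h (rdec x hx y hy h h') (linc x hx y hy h h'')
  have down : ∀ x ∈ S, ∀ y ∈ S, hgt x < hgt y → hgt q ≤ hgt x → d y < d x := fun x hx y hy h h' =>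
    hd x hx y hy h (rdec x hx y hy h (hpq.trans h')) (ldec x hx y hy h h')
  -- The three pieces fit together because `a p ≤ f p ≤ f q ≤ k - 1 - d q`.
  let φ : ι → ℕ := fun x => if hgt x ≤ hgt p then a x else if hgt x ≤ hgt q then f x else k - 1 - d x
  have hmono : ∀ x ∈ S, ∀ y ∈ S, hgt x < hgt y → φ x < φ y := by
    intro x hx y hy hxy
    have hpx : hgt x < hgt p → a x < a p := fun h => up x hx p hp h le_rfl
    have hxa : hgt x = hgt p → x = p := by
      intro h
      by_contra hne
      have := hinj x hx p hp hne
      omega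
    have hxq : hgt x = hgt q → x = q := by
      intro h
      by_contra hne
      have := hinj x hx q hq hne
      omega
    have hap := haf p hp
    have hfx := hfd x hx
    have hfy := hfd y hy
    have hfq := hfd q hq
    have hax : hgt x ≤ hgt p → a x ≤ a p := by
      intro h
      rcases h.lt_or_eq with h | h
      · exact (hpx h).le
      · rw [hxa h]
    have hfpq : f p ≤ f q := by
      rcases hpq.lt_or_eq with h | h
      · exact (mid p hp q hq h le_rfl le_rfl).le
      · obtain rfl : p = q := by
          by_contra hne
          have := hinj p hp q hq hne
          omega
        exact le_rfl
    have hfxq : hgt p ≤ hgt x → hgt x ≤ hgt q → f x ≤ f q := by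
      intro h' h
      rcases h.lt_or_eq with h | h
      · exact (mid x hx q hq h h' le_rfl).le
      · rw [hxq h]
    simp only [φ]
    split_ifs with h1 h2 h3 h4 h5 h6
    · exact up x hx y hy hxy h2
    · have := mid p hp y hy (by omega) le_rfl h3
      have := hax h1
      omega
    · have := hax h1
      have := down q hq y hy (by omega) le_rfl
      omega
    · omega
    · exact mid x hx y hy hxy (by omega) h6
    · have := hfxq (by omega) h4
      have := down q hq y hy (by omega) le_rfl
      omega
    · omega
    · omega
    · have := down x hx y hy hxy (by omega)
      omega
  have hφ : Set.MapsTo φ S (Finset.range k) := by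
    intro x hx
    have h1 := haf x hx
    have h2 := hfd x hx
    simp only [φ, Finset.coe_range, Set.mem_Iio]
    split_ifs <;> omega
  have hφinj : Set.InjOn φ S := by
    intro x hx y hy he
    by_contra hne
    rcases hinj x hx y hy hne with h | h
    · have := hmono x hx y hy h
      omega
    · have := hmono y hy x hx h
      omega
  simpa using Finset.card_le_card_of_injOn φ hφ hφinj

/-- The quadruples `(a, d, f, g)` with `a ≤ f, g` and `f + d, g + d < k`. -/
def types (k : ℕ) : Finset (Σ _ : ℕ, Σ _ : ℕ, ℕ × ℕ) :=
  (Finset.range k).sigma fun a => (Finset.range (k - a)).sigma fun d =>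
    Finset.Ico a (k - d) ×ˢ Finset.Ico a (k - d)

theorem sum_range_sub_eq (F : ℕ → ℕ) (n : ℕ) :
    ∑ i ∈ Finset.range n, F (n - i) = ∑ i ∈ Finset.range n, F (i + 1) := by
  rw [← Finset.sum_range_reflect]
  refine Finset.sum_congr rfl fun i hi => ?_
  rw [Finset.mem_range] at hi
  congr 1
  omega

/-- Given `a` and `d`, each of `f` and `g` has `k - a - d` choices, so the count is a double sum of
squares. -/
theorem card_types (k : ℕ) :
    ((types k).card : ℝ) = ((k : ℝ) + 1) / 2 * ((k + 2).choose 3 : ℝ) := by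
  have h1 : (types k).card = ∑ a ∈ Finset.range k, ∑ i ∈ Finset.range (a + 1), (i + 1) ^ 2 := by
    have : (types k).card = ∑ a ∈ Finset.range k, ∑ d ∈ Finset.range (k - a), (k - a - d) ^ 2 := by
      simp only [types, Finset.card_sigma, Finset.card_product, Nat.card_Ico]
      refine Finset.sum_congr rfl fun a _ => Finset.sum_congr rfl fun d _ => ?_
      rw [sq, Nat.sub_right_comm]
    rw [this, sum_range_sub_eq (fun n => ∑ d ∈ Finset.range n, (n - d) ^ 2)]
    exact Finset.sum_congr rfl fun a _ => sum_range_sub_eq (fun n => n ^ 2) (a + 1)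
  have h2 : ∀ n : ℕ, 6 * ∑ i ∈ Finset.range n, (i + 1) ^ 2 = n * (n + 1) * (2 * n + 1) := by
    intro n
    induction n with
    | zero => simp
    | succ n ih => rw [Finset.sum_range_succ, mul_add, ih]; ring
  have h3 : ∀ n : ℕ, 12 * ∑ a ∈ Finset.range n, ∑ i ∈ Finset.range (a + 1), (i + 1) ^ 2
      = (n + 1) * ((n + 2) * (n + 1) * n) := by
    intro n
    induction n with
    | zero => simp
    | succ n ih =>
      rw [Finset.sum_range_succ, mul_add, ih, show 12 = 2 * 6 from rfl, mul_assoc 2 6, h2]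
      ring
  have h4 : (k + 2).choose 3 * 6 = (k + 2) * (k + 1) * k := by
    have e1 := Nat.add_one_mul_choose_eq (k + 1) 2
    have e2 := Nat.add_one_mul_choose_eq k 1
    rw [Nat.choose_one_right] at e2
    calc (k + 2).choose 3 * 6 = ((k + 1 + 1).choose (2 + 1) * (2 + 1)) * 2 := by ring
      _ = (k + 2) * ((k + 1).choose (1 + 1) * (1 + 1)) := by rw [← e1]; ring
      _ = (k + 2) * (k + 1) * k := by rw [← e2]; ring
  have h5 := h3 k
  rw [← h1, ← h4] at h5
  have h6 : (12 : ℝ) * (types k).card = ((k : ℝ) + 1) * ((k + 2).choose 3 * 6) := by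
    exact_mod_cast h5
  linarith

/-- Height of a type: lexicographic, increasing in `a`, decreasing in `d`. -/
def typeHeight (k : ℕ) (t : Σ _ : ℕ, Σ _ : ℕ, ℕ × ℕ) : ℕ :=
  digits (k + 1) t.1 (k - t.2.1) t.2.2.1 t.2.2.2

/-- Right extent of a type: lexicographic, decreasing in `f`. -/
def typeRight (k : ℕ) (t : Σ _ : ℕ, Σ _ : ℕ, ℕ × ℕ) : ℕ :=
  digits (k + 1) t.1 t.2.1 (k - t.2.2.1) t.2.2.2

/-- Left extent of a type: lexicographic, decreasing in `g`. -/
def typeLeft (k : ℕ) (t : Σ _ : ℕ, Σ _ : ℕ, ℕ × ℕ) : ℕ :=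
  digits (k + 1) t.1 t.2.1 t.2.2.1 (k - t.2.2.2)

theorem mem_types_iff {k : ℕ} {t : Σ _ : ℕ, Σ _ : ℕ, ℕ × ℕ} :
    t ∈ types k ↔ t.1 ≤ t.2.2.1 ∧ t.1 ≤ t.2.2.2 ∧ t.2.2.1 + t.2.1 < k ∧ t.2.2.2 + t.2.1 < k := by
  simp only [types, Finset.mem_sigma, Finset.mem_range, Finset.mem_product, Finset.mem_Ico]
  omega

theorem typeHeight_injOn (k : ℕ) : Set.InjOn (typeHeight k) (types k) := by
  rintro ⟨a, d, f, g⟩ hs ⟨a', d', f', g'⟩ ht he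
  obtain ⟨-, -, h1, h2⟩ := mem_types_iff.mp hs
  obtain ⟨-, -, h3, h4⟩ := mem_types_iff.mp ht
  dsimp only at h1 h2 h3 h4
  have e1 := he.not_lt
  have e2 := he.not_gt
  unfold typeHeight at e1 e2
  rw [digits_lt_digits_iff (by omega) (by omega) (by dsimp only; omega) (by dsimp only; omega)
    (by dsimp only; omega) (by dsimp only; omega)] at e1 e2
  dsimp only at e1 e2
  obtain ⟨rfl, rfl, rfl, rfl⟩ : a = a' ∧ d = d' ∧ f = f' ∧ g = g' := by omega
  rfl

/-- The first coordinate in which two types differ decides all three lexicographic comparisons.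
Relative to height, the pair (right, left) moves as (up, up) for `a`, (down, down) for `d`, (down,
up) for `f` and (up, down) for `g`, so the signs reveal that coordinate. -/
theorem types_sign_conditions {k : ℕ} {s t : Σ _ : ℕ, Σ _ : ℕ, ℕ × ℕ} (hs : s ∈ types k)
    (ht : t ∈ types k) (h : typeHeight k s < typeHeight k t) :
    (typeRight k s ≠ typeRight k t ∧ typeLeft k s ≠ typeLeft k t) ∧
    (typeRight k s < typeRight k t → typeLeft k s < typeLeft k t → s.1 < t.1) ∧
    (typeRight k t < typeRight k s → typeLeft k t < typeLeft k s → t.2.1 < s.2.1) ∧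
    (typeRight k t < typeRight k s → typeLeft k s < typeLeft k t → s.2.2.1 < t.2.2.1) ∧
    (typeRight k s < typeRight k t → typeLeft k t < typeLeft k s → s.2.2.2 < t.2.2.2) := by
  obtain ⟨-, -, h1, h2⟩ := mem_types_iff.mp hs
  obtain ⟨-, -, h3, h4⟩ := mem_types_iff.mp ht
  obtain ⟨a, d, f, g⟩ := s
  obtain ⟨a', d', f', g'⟩ := t
  simp only [ne_iff_lt_or_gt]
  unfold typeHeight at h
  unfold typeRight typeLeft
  dsimp only at h1 h2 h3 h4 h ⊢
  rw [digits_lt_digits_iff (by omega) (by omega) (by omega) (by omega) (by omega) (by omega)] at h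
  rw [digits_lt_digits_iff (x := a) (z := k - f) (by omega) (by omega) (by omega) (by omega)
      (by omega) (by omega),
    digits_lt_digits_iff (x := a') (z := k - f') (by omega) (by omega) (by omega) (by omega)
      (by omega) (by omega),
    digits_lt_digits_iff (x := a) (z := f) (by omega) (by omega) (by omega) (by omega)
      (by omega) (by omega),
    digits_lt_digits_iff (x := a') (z := f') (by omega) (by omega) (by omega) (by omega)
      (by omega) (by omega)]
  omega

theorem ReachWithin.eq_or_lt {V : Type*} {Arc : V → V → Prop} {S : V → Prop} {lev : V → ℕ}
    (hlev : ∀ u v, Arc u v → lev u < lev v) {u w : V} (h : ReachWithin Arc S u w) :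
    u = w ∨ lev u < lev w := by
  obtain ⟨-, h⟩ := h
  induction h with
  | refl => exact Or.inl rfl
  | tail _ hxy ih =>
    have := hlev _ _ hxy.1
    rcases ih with rfl | ih
    · exact Or.inr this
    · exact Or.inr (ih.trans this)

/-! ### Lower bound -/

theorem card_types_le_of_colorsSuffice {k m : ℕ} (h : ColorsSuffice k m) :
    (types k).card ≤ m := by
  classical
  obtain ⟨V, _, Arc, lev, hlt, hlev, huniq, hcol⟩ := exists_unipathic_digraph (types k).card
  -- There are as many available levels as types; level `i` receives the `i`-th type in order of
  -- height.
  obtain ⟨typ, hmem, hmono⟩ : ∃ typ : V → Σ _ : ℕ, Σ _ : ℕ, ℕ × ℕ, (∀ v, typ v ∈ types k) ∧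
      ∀ u v, lev u < lev v ↔ typeHeight k (typ u) < typeHeight k (typ v) := by
    have hc : ((types k).image (typeHeight k)).card = (types k).card :=
      Finset.card_image_of_injOn (typeHeight_injOn k)
    let e := ((types k).image (typeHeight k)).orderEmbOfFin hc
    have he : ∀ i, ∃ t ∈ types k, typeHeight k t = e i := fun i =>
      Finset.mem_image.mp (Finset.orderEmbOfFin_mem _ hc i)
    choose t ht hte using he
    refine ⟨fun v => t ⟨lev v, hlt v⟩, fun v => ht _, fun u v => ?_⟩
    rw [hte, hte, e.lt_iff_lt, Fin.mk_lt_mk]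
  set r : V → ℕ := fun v => typeRight k (typ v)
  set l : V → ℕ := fun v => typeLeft k (typ v)
  obtain ⟨γ, hγ, hdisj, hreach⟩ := exists_xMonotoneCurves Arc lev r l hlev
  have hne : ∀ v, (γ v).Nonempty := by
    intro v
    obtain ⟨⟨φ, -, hφ⟩, -⟩ := hγ v
    rw [← hφ]
    exact Set.range_nonempty φ
  have hclique : ∀ S : Finset V, (∀ x ∈ S, ∀ y ∈ S, x ≠ y → Disjoint (γ x) (γ y)) →
      S.card ≤ k := by
    intro S hS
    have hpath : ∀ x ∈ S, ∀ y ∈ S, lev x < lev y →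
        ReachWithin Arc (fun z => min (r x) (r y) ≤ r z) x y ∧
        ReachWithin Arc (fun z => min (l x) (l y) ≤ l z) x y := fun x hx y hy hxy =>
      hreach x y hxy.le (hS x hx y hy fun he => by rw [he] at hxy; exact hxy.false)
    have hinj : ∀ x ∈ S, ∀ y ∈ S, x ≠ y → lev x < lev y ∨ lev y < lev x := by
      intro x hx y hy hxy
      rcases lt_trichotomy (lev x) (lev y) with h | h | h
      · exact Or.inl h
      · have := (hreach x y h.le (hS x hx y hy hxy)).1.eq_or_lt hlev
        exact (this.elim hxy h.not_lt).elim
      · exact Or.inr h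
    have hbetween : ∀ x ∈ S, ∀ y ∈ S, ∀ z ∈ S, lev x < lev y → lev y < lev z →
        min (r x) (r z) ≤ r y ∧ min (l x) (l z) ≤ l y := by
      intro x hx y hy z hz hxy hyz
      have h1 := (hpath x hx y hy hxy).1.mono (S' := fun _ => True) fun _ _ => trivial
      have h2 := (hpath y hy z hz hyz).1.mono (S' := fun _ => True) fun _ _ => trivial
      have h3 := hpath x hx z hz (hxy.trans hyz)
      exact ⟨huniq _ x y z h1 h2 h3.1, huniq _ x y z h1 h2 h3.2⟩
    have hsign := fun x (_ : x ∈ S) y (_ : y ∈ S) (hxy : lev x < lev y) =>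
      types_sign_conditions (hmem x) (hmem y) ((hmono x y).mp hxy)
    rcases S.eq_empty_or_nonempty with rfl | hSne
    · simp
    obtain ⟨p, hp, hpmax⟩ := S.exists_max_image r hSne
    obtain ⟨q, hq, hqmax⟩ := S.exists_max_image l hSne
    have hT := fun x => mem_types_iff.mp (hmem x)
    rcases le_total (lev p) (lev q) with hpq | hpq
    · exact card_le_of_bimonotone S k lev r l (fun x => (typ x).1) (fun x => (typ x).2.1)
        (fun x => (typ x).2.2.1) hinj (fun x _ => (hT x).1) (fun x _ => (hT x).2.2.1)
        (fun x hx y hy z hz h h' => (hbetween x hx y hy z hz h h').1)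
        (fun x hx y hy z hz h h' => (hbetween x hx y hy z hz h h').2)
        (fun x hx y hy h => (hsign x hx y hy h).1)
        (fun x hx y hy h => (hsign x hx y hy h).2.1)
        (fun x hx y hy h => (hsign x hx y hy h).2.2.1)
        (fun x hx y hy h => (hsign x hx y hy h).2.2.2.1) hp hpmax hq hqmax hpq
    -- Mirror image: with the left peak first, `g` takes over the role of `f`.
    · exact card_le_of_bimonotone S k lev l r (fun x => (typ x).1) (fun x => (typ x).2.1)
        (fun x => (typ x).2.2.2) hinj (fun x _ => (hT x).2.1) (fun x _ => (hT x).2.2.2)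
        (fun x hx y hy z hz h h' => (hbetween x hx y hy z hz h h').2)
        (fun x hx y hy z hz h h' => (hbetween x hx y hy z hz h h').1)
        (fun x hx y hy h => (hsign x hx y hy h).1.symm)
        (fun x hx y hy h h' h'' => (hsign x hx y hy h).2.1 h'' h')
        (fun x hx y hy h h' h'' => (hsign x hx y hy h).2.2.1 h'' h')
        (fun x hx y hy h h' h'' => (hsign x hx y hy h).2.2.2.2 h'' h') hq hqmax hp hpmax hpq
  have hfree : (disjointnessGraph (Set.range γ)).CliqueFree (k + 1) := by
    rintro s ⟨hs, hcard⟩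
    -- Distinct vertices may carry the same curve, so one vertex is chosen for each curve of the
    -- clique.
    choose pre hpre using fun C : Set.range γ => C.2
    have hpreinj : Function.Injective pre := fun C D h =>
      Subtype.ext (by rw [← hpre C, ← hpre D, h])
    have := hclique (s.image pre) ?_
    · rw [Finset.card_image_of_injective _ hpreinj, hcard] at this
      omega
    · intro x hx y hy hxy
      obtain ⟨C, hC, rfl⟩ := Finset.mem_image.mp hx
      obtain ⟨D, hD, rfl⟩ := Finset.mem_image.mp hy
      rw [hpre, hpre]
      exact (hs hC hD fun h => hxy (by rw [h])).2
  obtain ⟨c⟩ := h (Set.range γ) (by rintro _ ⟨v, rfl⟩; exact hγ v) hfree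
  -- Arcs join disjoint nonempty curves, which are therefore distinct and adjacent, so coloring the
  -- curves properly colors the digraph.
  have hle := hcol (fun v => (c ⟨γ v, v, rfl⟩ : ℕ)) fun u v huv he => by
    have hd := hdisj u v huv
    have hadj : (disjointnessGraph (Set.range γ)).Adj ⟨γ u, u, rfl⟩ ⟨γ v, v, rfl⟩ := by
      refine ⟨fun h => (hne u).ne_empty ?_, hd⟩
      rw [show γ v = γ u from (congrArg Subtype.val h).symm, disjoint_self] at hd
      exact hd
    exact c.valid hadj (Fin.ext he)
  refine hle.trans ?_
  calc _ ≤ (Finset.range m).card := Finset.card_le_card fun i hi => by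
        obtain ⟨v, -, rfl⟩ := Finset.mem_image.mp hi
        exact Finset.mem_range.mpr (Fin.is_lt _)
    _ = m := Finset.card_range m

theorem theorem5 :
    ∃ f : ℕ → ℕ, ∀ k : ℕ, 1 ≤ k →
      IsLeast {m : ℕ | ColorsSuffice k m} (f k) ∧
      IsLeast {m : ℕ | ColorsSufficeFinite k m} (f k) ∧
      ((k : ℝ) + 1) / 2 * ((k + 2).choose 3 : ℝ) ≤ (f k : ℝ) ∧
      (f k : ℝ) ≤ (k : ℝ) ^ 2 * ((k + 1).choose 2 : ℝ) := by
  refine ⟨fun k => sInf {m : ℕ | ColorsSuffice k m}, fun k _ => ?_⟩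
  have hup := colorsSuffice_sq_mul_choose k
  have hleast : IsLeast {m : ℕ | ColorsSuffice k m} (sInf {m : ℕ | ColorsSuffice k m}) :=
    ⟨Nat.sInf_mem ⟨_, hup⟩, fun m hm => Nat.sInf_le hm⟩
  refine ⟨hleast, ?_, ?_, ?_⟩
  · have : {m : ℕ | ColorsSufficeFinite k m} = {m : ℕ | ColorsSuffice k m} :=
      Set.ext fun m => (colorsSuffice_iff_colorsSufficeFinite k m).symm
    rw [this]
    exact hleast
  · rw [← card_types]
    exact_mod_cast card_types_le_of_colorsSuffice hleast.1
  · exact_mod_cast hleast.2 hup
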